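/- Let $k$ be a field of characteristic zero and let $R$ be a finitely generated $k$-algebra which is a unique factorization domain. Let $B=R[X,Y]$ be the polynomial ring in two variables and let $D:B\to B$ be a locally nilpotent $R$-derivation (for every $b\in B$ there is $m\ge 0$ with $D^m b=0$) such that - $D$ is irreducible: there is no non-unit $b\in B$ with $DB\subseteq bB$; - $D$ is nice: there are $U,V\in B$, algebraically independent over $R$, with $B=R[U,V]$ and $D^2U=D^2V=0$. Let $A=\{b\in B : Db=0\}$ be the kernel of $D$, and for $n\ge 1$ let $I_n=A\cap D^nB$ (the $n$-th image ideal of $D$, an ideal of $A$). Call $D$ fixed point free if the ideal of $B$ generated by $DB$ is $B$. Then: 1. If $D$ is fixed point free, then $I_n=A$ for every $n\ge 1$. 2. If $D$ is not fixed point free, then for every $n\ge 1$ the ideal $I_n$ of $A$ is generated by $n+1$ elements of $R$, $\operatorname{grade}_A(I_n)=2$ (that is, the maximal length of an $A$-regular sequence contained in $I_n$ is $2$), and $I_n$ is not principal. 3. Consequently, the image ideals $I_n$, $n\ge1$, are all principal if and only if $D$ is fixed point free. -/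

import Mathlib

namespace LND

section

variable {R B : Type*} [CommRing R] [CommRing B] [Algebra R B]

/-- `D` is a locally nilpotent `R`-derivation (an `R`-lnd) of `B`. -/
def IsLocallyNilpotent (D : Derivation R B B) : Prop :=
  ∀ b : B, ∃ n : ℕ, D^[n] b = 0

/-- `D` is irreducible: no non-unit `b` of `B` satisfies `D B ⊆ b B`. -/
def IsIrreducible (D : Derivation R B B) : Prop :=
  ¬ ∃ b : B, ¬ IsUnit b ∧ ∀ x : B, D x ∈ Ideal.span {b}

/-- `D` is fixed point free: the ideal `(D B) B` generated by the image of `D` is `B`. -/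
def IsFixedPointFree (D : Derivation R B B) : Prop :=
  Ideal.span (Set.range D) = ⊤

variable (R) in
/-- `x` is a coordinate system of the `R`-algebra `B`: the elements `x 0, …, x (n - 1)` are
algebraically independent over `R` and generate `B`, so that `B = R[x 0, …, x (n - 1)]` is a
polynomial algebra in them. -/
def IsCoordinateSystem {n : ℕ} (x : Fin n → B) : Prop :=
  Function.Bijective (MvPolynomial.aeval x : MvPolynomial (Fin n) R →ₐ[R] B)

/-- `D` is nice (on `B`, a polynomial algebra in `n` variables over `R`): `D² xᵢ = 0` for all
members `xᵢ` of some coordinate system of `B`. -/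
def IsNice (n : ℕ) (D : Derivation R B B) : Prop :=
  ∃ x : Fin n → B, IsCoordinateSystem R x ∧ ∀ i, D (D (x i)) = 0

/-- The kernel `{b | D b = 0}` of `D`, as an `R`-subalgebra of `B`. -/
def kernel (D : Derivation R B B) : Subalgebra R B where
  carrier := {b | D b = 0}
  mul_mem' {a b} ha hb := by
    simp only [Set.mem_ofPred_eq] at ha hb ⊢
    simp [Derivation.leibniz, ha, hb]
  add_mem' {a b} ha hb := by
    simp only [Set.mem_ofPred_eq] at ha hb ⊢
    simp [ha, hb]
  algebraMap_mem' r := D.map_algebraMap r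

theorem iterate_add (D : Derivation R B B) (n : ℕ) (x y : B) :
    D^[n] (x + y) = D^[n] x + D^[n] y := by
  induction n with
  | zero => rfl
  | succ n ih => simp only [Function.iterate_succ_apply', ih, map_add]

theorem iterate_mul (D : Derivation R B B) (n : ℕ) {a : B} (ha : D a = 0) (x : B) :
    D^[n] (a * x) = a * D^[n] x := by
  induction n with
  | zero => rfl
  | succ n ih => simp [Function.iterate_succ_apply', ih, Derivation.leibniz, ha]

/-- The `n`-th image ideal `Iₙ = A ∩ Dⁿ B` of `D`, an ideal of the kernel `A` of `D`. -/
def imageIdeal (D : Derivation R B B) (n : ℕ) : Ideal (kernel D) where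
  carrier := {a | ∃ b : B, D^[n] b = (a : B)}
  add_mem' := by
    rintro a b ⟨x, hx⟩ ⟨y, hy⟩
    exact ⟨x + y, by rw [iterate_add, hx, hy]; rfl⟩
  zero_mem' := by
    refine ⟨0, ?_⟩
    simpa only [zero_mul, ZeroMemClass.coe_zero] using iterate_mul D n (a := 0) (map_zero D) 0
  smul_mem' := by
    rintro c a ⟨x, hx⟩
    exact ⟨(c : B) * x, by rw [iterate_mul D n c.2, hx]; rfl⟩

end

/-- The grade of an ideal `I` of a (Noetherian) ring `A`: the maximal length of an `A`-regular
sequence contained in `I`. -/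
noncomputable def grade {A : Type*} [CommRing A] (I : Ideal A) : ℕ∞ :=
  ⨆ rs ∈ {rs : List A | RingTheory.Sequence.IsRegular A rs ∧ ∀ r ∈ rs, r ∈ I},
    (rs.length : ℕ∞)

end LND

/-! ### Regular sequences and powers of two-generated ideals. -/

namespace LND

/-! In nice coordinates an irreducible `D` is `a ∂/∂X + b ∂/∂Y` with `a`, `b` relatively prime in
`R` (`exists_model`). The core is `Iₙ = (a, b)ⁿ A` (`imageIdeal_eq_map`). A form `f` of degree `n`
has `Dⁿ f = n! f(a, b)`, and `n!` is a unit, which gives `⊇`. Conversely, if `Dⁿ⁺¹` kills a form of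
degree `n + k`, that form is `Wᵏ g` with `W = bX - aY` in the kernel and `g` of degree `n`, so its
image under `Dⁿ` is `n! g(a, b) Wᵏ`.

Fixed point freeness means `(a, b) = R`. Otherwise `aⁿ, bⁿ` is a regular sequence in `Iₙ`, and `Iₙ`
lies in the proper ideal `(a, b) A`, which contains no regular sequence of length three; so the
grade is 2. A single generator of `Iₙ` would divide `aⁿ` and `bⁿ`, hence be a unit. -/

/-- If `p` and `q` are relatively prime, then common divisors of `p * f` and `q * f` divide `f`. -/
theorem dvd_of_dvd_mul_of_isRelPrime {B : Type*} [CommRing B] [IsDomain B] [DecompositionMonoid B]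
    {p q w f : B} (h : IsRelPrime p q) (hp : w ∣ p * f) (hq : w ∣ q * f) : w ∣ f := by
  obtain ⟨s, hs⟩ := hp
  obtain ⟨t, ht⟩ := hq
  by_cases hp0 : p = 0
  · subst hp0
    obtain ⟨u, rfl⟩ := isRelPrime_zero_left.1 h
    exact (Units.dvd_mul_left (u := u)).1 ⟨t, ht⟩
  by_cases hw : w = 0
  · subst hw
    have : f = 0 := by simpa [hp0] using hs
    simp [this]
  have hst : q * s = p * t := by
    apply mul_left_cancel₀ hw
    linear_combination p * ht - q * hs
  obtain ⟨s', rfl⟩ : p ∣ s := h.dvd_of_dvd_mul_left ⟨t, hst⟩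
  refine ⟨s', mul_left_cancel₀ hp0 ?_⟩
  rw [hs]; ring

/-- A proper ideal contained in one generated by two elements contains no weakly regular
sequence of length three. -/
theorem eq_top_of_isSMulRegular_three {A : Type*} [CommRing A] {a b x y z : A}
    (hx : ∀ t, x * t = 0 → t = 0)
    (hy : ∀ t, y * t ∈ Ideal.span {x} → t ∈ Ideal.span {x})
    (hz : ∀ t, z * t ∈ Ideal.span {x, y} → t ∈ Ideal.span {x, y})
    (hxJ : x ∈ Ideal.span {a, b}) (hyJ : y ∈ Ideal.span {a, b}) (hzJ : z ∈ Ideal.span {a, b}) :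
    Ideal.span {a, b} = ⊤ := by
  obtain ⟨x₁, x₂, hx'⟩ := Ideal.mem_span_pair.1 hxJ
  obtain ⟨y₁, y₂, hy'⟩ := Ideal.mem_span_pair.1 hyJ
  obtain ⟨z₁, z₂, hz'⟩ := Ideal.mem_span_pair.1 hzJ
  -- By Cramer's rule the determinant of `x, y` in terms of `a, b` multiplies `a` and `b`, hence
  -- `z`, into `(x, y)`; regularity of `z` puts it in `(x, y)`.
  obtain ⟨u, v, huv⟩ := Ideal.mem_span_pair.1 (hz (x₁ * y₂ - x₂ * y₁)
    (Ideal.mem_span_pair.2 ⟨z₁ * y₂ - z₂ * y₁, -z₁ * x₂ + z₂ * x₁, by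
      linear_combination (-y₂ * z₁ + z₂ * y₁) * hx' + (z₁ * x₂ - z₂ * x₁) * hy'
        + (x₁ * y₂ - x₂ * y₁) * hz'⟩))
  obtain ⟨c, hc⟩ := Ideal.mem_span_singleton'.1 (hy (v * a + x₂)
    (Ideal.mem_span_singleton'.2 ⟨y₂ - u * a, by
      linear_combination -y₂ * hx' + x₂ * hy' - a * huv⟩))
  obtain ⟨d, hd⟩ := Ideal.mem_span_singleton'.1 (hy (v * b - x₁)
    (Ideal.mem_span_singleton'.2 ⟨-y₁ - u * b, by
      linear_combination y₁ * hx' - x₁ * hy' - b * huv⟩))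
  -- Eliminating `v` from `v a + x₂ = c x` and `v b - x₁ = d x` gives `x (c b - d a) = x₁ a + x₂ b =
  -- x`.
  have h1 := hx (c * b - d * a - 1) (by linear_combination hx' + b * hc - a * hd)
  rw [Ideal.eq_top_iff_one]
  exact Ideal.mem_span_pair.2 ⟨-d, c, by linear_combination h1⟩

theorem grade_le_two {A : Type*} [CommRing A] {a b : A} {I : Ideal A}
    (hI : I ≤ Ideal.span {a, b}) (hJ : Ideal.span {a, b} ≠ ⊤) : grade I ≤ 2 := by
  refine iSup₂_le fun rs ⟨hrs, hmem⟩ => ?_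
  match rs, hrs, hmem with
  | [], _, _ => simp
  | [_], _, _ => simp
  | [_, _], _, _ => simp
  | x :: y :: z :: l, hrs, hmem =>
    exfalso
    apply hJ
    have h := hrs.toIsWeaklyRegular.regular_mod_prev
    have h0 := h 0 (by simp)
    have h1 := h 1 (by simp)
    have h2 := h 2 (by simp)
    simp only [isSMulRegular_quotient_iff_mem_of_smul_mem] at h0 h1 h2
    simp at h0 h1 h2
    refine eq_top_of_isSMulRegular_three (x := x) (y := y) (z := z) h0 h1 ?_
      (hI (hmem _ (by simp))) (hI (hmem _ (by simp))) (hI (hmem _ (by simp)))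
    simpa [Ideal.span_insert] using h2

theorem two_le_grade {A : Type*} [CommRing A] {a b : A} {I : Ideal A} (hI : I ≠ ⊤)
    (ha : a ∈ I) (hb : b ∈ I) (ha0 : ∀ t, a * t = 0 → t = 0)
    (hab : ∀ t, b * t ∈ Ideal.span {a} → t ∈ Ideal.span {a}) : 2 ≤ grade I := by
  have : RingTheory.Sequence.IsRegular A [a, b] := by
    refine ⟨⟨fun i hi => ?_⟩, fun h => hI ?_⟩
    · rw [isSMulRegular_quotient_iff_mem_of_smul_mem]
      match i, hi with
      | 0, _ => simpa using ha0
      | 1, _ => simpa using hab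
    · rw [eq_top_iff]
      have h' : (⊤ : Ideal A) = Ideal.span {a} ⊔ Ideal.span {b} := by simpa using h
      rw [h', sup_le_iff]
      simp [Ideal.span_le, ha, hb]
  exact le_iSup₂_of_le (f := fun (rs : List A) _ => (rs.length : ℕ∞)) [a, b]
    ⟨this, by simp [ha, hb]⟩ (by simp)

theorem span_pair_pow {A : Type*} [CommRing A] (a b : A) (n : ℕ) :
    Ideal.span {a, b} ^ n =
      Ideal.span (Set.range fun i : Fin (n + 1) => a ^ (i : ℕ) * b ^ (n - i : ℕ)) := by
  apply le_antisymm
  · rw [Ideal.span_insert, ← Ideal.add_eq_sup, add_pow, Ideal.sum_eq_sup]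
    refine Finset.sup_le ?_
    intro i hi
    refine Ideal.mul_le_left.trans ?_
    rw [Ideal.span_singleton_pow, Ideal.span_singleton_pow, Ideal.span_singleton_mul_span_singleton,
      Ideal.span_singleton_le_iff_mem]
    exact Ideal.subset_span ⟨⟨i, Finset.mem_range.1 hi⟩, rfl⟩
  · rw [Ideal.span_le]
    rintro _ ⟨i, rfl⟩
    have h : Ideal.span {a, b} ^ n = Ideal.span {a, b} ^ (i : ℕ) * Ideal.span {a, b} ^ (n - i) := by
      rw [← pow_add]; congr; omega
    rw [h]
    exact Ideal.mul_mem_mul (Ideal.pow_mem_pow (Ideal.subset_span (by simp)) _)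
      (Ideal.pow_mem_pow (Ideal.subset_span (by simp)) _)

end LND

/-! ### The derivation `a ∂/∂X + b ∂/∂Y` on homogeneous forms. -/

namespace LND

open MvPolynomial

section

variable {R σ : Type*} [CommRing R]

/-- A nonzero `∂f/∂Xᵢ` has smaller degree in `Xᵢ` than `f`, whereas over a domain a nonzero multiple
of `f` does not. -/
theorem pderiv_eq_zero_of_dvd [IsDomain R] {i : σ} {f : MvPolynomial σ R} (h : f ∣ pderiv i f) :
    pderiv i f = 0 := by
  by_contra hne
  obtain ⟨m, hm, hmi⟩ : ∃ m ∈ (pderiv i f).support, m i = degreeOf i (pderiv i f) := by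
    rw [degreeOf_eq_sup]
    obtain ⟨m, hm, h⟩ := Finset.exists_mem_eq_sup (pderiv i f).support
      (support_nonempty.2 hne) (fun m => m i)
    exact ⟨m, hm, h.symm⟩
  rw [mem_support_iff, coeff_pderiv] at hm
  have h1 := monomial_le_degreeOf i (mem_support_iff.2 (left_ne_zero_of_mul hm))
  have h2 : degreeOf i f ≤ degreeOf i (pderiv i f) := by
    obtain ⟨g, hg⟩ := h
    rw [hg] at hne ⊢
    rw [degreeOf_mul_eq (left_ne_zero_of_mul hne) (right_ne_zero_of_mul hne)]
    omega
  simp at h1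
  omega

theorem exists_eq_C_of_pderiv_eq_zero [IsDomain R] [CharZero R] {f : MvPolynomial σ R}
    (h : ∀ i, pderiv i f = 0) :
    ∃ r, f = C r := by
  refine ⟨coeff 0 f, ?_⟩
  ext m
  classical
  rw [coeff_C]
  split_ifs with hm
  · rw [hm]
  · obtain ⟨i, hi⟩ := Finsupp.ne_iff.1 (Ne.symm hm)
    have := congrArg (coeff (m - Finsupp.single i 1)) (h i)
    rw [coeff_pderiv, coeff_zero, mul_eq_zero, tsub_add_cancel_of_le] at this
    · refine this.resolve_right ?_
      exact Nat.cast_add_one_ne_zero _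
    · simpa [Finsupp.single_le_iff, Nat.one_le_iff_ne_zero] using hi

end

section

variable {R : Type*} [CommRing R] {a b : R}
  {D : Derivation R (MvPolynomial (Fin 2) R) (MvPolynomial (Fin 2) R)}

theorem isHomogeneous_of_eq_pderiv (hD : ∀ f, D f = C a * pderiv 0 f + C b * pderiv 1 f)
    {n : ℕ} {f : MvPolynomial (Fin 2) R} (hf : f.IsHomogeneous n) :
    (D f).IsHomogeneous (n - 1) := by
  rw [hD]
  exact (hf.pderiv.C_mul a).add (hf.pderiv.C_mul b)

theorem isHomogeneous_iterate (hD : ∀ f, D f = C a * pderiv 0 f + C b * pderiv 1 f)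
    (k : ℕ) {n : ℕ} {f : MvPolynomial (Fin 2) R} (hf : f.IsHomogeneous n) :
    (D^[k] f).IsHomogeneous (n - k) := by
  induction k with
  | zero => exact hf
  | succ k ih =>
    rw [Function.iterate_succ_apply', ← Nat.sub_sub]
    exact isHomogeneous_of_eq_pderiv hD ih

/-- Induction through Euler's identity: evaluated at `(a, b)`, it says that `D f` takes the value
`(n + 1) f(a, b)` when `f` has degree `n + 1`. -/
theorem iterate_eq_factorial_mul_eval (hD : ∀ f, D f = C a * pderiv 0 f + C b * pderiv 1 f)
    (n : ℕ) {f : MvPolynomial (Fin 2) R} (hf : f.IsHomogeneous n) :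
    D^[n] f = C (n.factorial * eval ![a, b] f) := by
  induction n generalizing f with
  | zero =>
    rw [← totalDegree_zero_iff_isHomogeneous, totalDegree_eq_zero_iff_eq_C] at hf
    rw [hf]; simp
  | succ n ih =>
    rw [Function.iterate_succ_apply, ih (isHomogeneous_of_eq_pderiv hD hf)]
    have h := congrArg (eval ![a, b]) hf.sum_X_mul_pderiv
    simp [Fin.sum_univ_two] at h
    congr 1
    rw [hD, Nat.factorial_succ]
    push_cast
    simp
    linear_combination (n.factorial : R) * h

theorem iterate_zero (D : Derivation R (MvPolynomial (Fin 2) R) (MvPolynomial (Fin 2) R))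
    (n : ℕ) : D^[n] 0 = 0 :=
  Function.iterate_fixed (map_zero D) n

theorem iterate_eq_zero_of_lt (hD : ∀ f, D f = C a * pderiv 0 f + C b * pderiv 1 f)
    {m n : ℕ} (hmn : m < n) {f : MvPolynomial (Fin 2) R} (hf : f.IsHomogeneous m) :
    D^[n] f = 0 := by
  obtain ⟨k, rfl⟩ := Nat.exists_eq_add_of_lt hmn
  rw [show m + k + 1 = k + 1 + m by ring, Function.iterate_add_apply,
    iterate_eq_factorial_mul_eval hD m hf, Function.iterate_succ_apply]
  have : D (C (m.factorial * eval ![a, b] f)) = 0 := D.map_algebraMap _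
  rw [this, iterate_zero]

theorem iterate_sum (D : Derivation R (MvPolynomial (Fin 2) R) (MvPolynomial (Fin 2) R))
    (n : ℕ) {ι : Type*} (s : Finset ι) (f : ι → MvPolynomial (Fin 2) R) :
    D^[n] (∑ i ∈ s, f i) = ∑ i ∈ s, D^[n] (f i) := by
  have h : ∀ x, D^[n] x = ((D : _ →ₗ[R] _) ^ n) x := fun x => by
    rw [Module.End.pow_apply]; rfl
  simp only [h, map_sum]

/-- The linear form killed by `a ∂/∂X + b ∂/∂Y`. -/
noncomputable def linearKernel (a b : R) : MvPolynomial (Fin 2) R := C b * X 0 - C a * X 1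

theorem isHomogeneous_linearKernel (a b : R) : (linearKernel a b).IsHomogeneous 1 :=
  (isHomogeneous_C_mul_X b 0).sub (isHomogeneous_C_mul_X a 1)

theorem aeval_mul_of_isHomogeneous {σ Q : Type*} [Fintype σ] [CommRing Q] [Algebra R Q] {m : ℕ}
    {f : MvPolynomial σ R} (hf : f.IsHomogeneous m) (c : Q) (v : σ → Q) :
    aeval (fun j => c * v j) f = c ^ m * aeval v f := by
  rw [aeval_def, aeval_def, eval₂_eq', eval₂_eq', Finset.mul_sum]
  refine Finset.sum_congr rfl fun d hd => ?_
  have hm : m = ∑ i, d i := (hf.degree_eq_sum_deg_support hd).trans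
    (Finset.sum_subset (Finset.subset_univ _) (by simp))
  simp only [mul_pow, Finset.prod_mul_distrib, Finset.prod_pow_eq_pow_sum, ← hm]
  ring

theorem algebraMap_eval {σ Q : Type*} [CommRing Q] [Algebra R Q] (v : σ → R)
    (f : MvPolynomial σ R) :
    algebraMap R Q (eval v f) = aeval (fun j => algebraMap R Q (v j)) f := by
  rw [← aeval_eq_eval]
  exact (aeval_algebraMap_apply Q v f).symm

/-- Modulo `bX - aY` the vectors `(X, Y)` and `(a, b)` are proportional, so homogeneity compares the
values of `f` at both. -/
theorem linearKernel_dvd_pow_mul_sub (a b : R) {m : ℕ} {f : MvPolynomial (Fin 2) R}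
    (hf : f.IsHomogeneous m) (i : Fin 2) :
    linearKernel a b ∣ C (![a, b] i) ^ m * f - X i ^ m * C (eval ![a, b] f) := by
  let q := Ideal.Quotient.mkₐ R (Ideal.span {linearKernel a b})
  have hW : C b * X 0 - C a * X 1 ∈ Ideal.span {linearKernel a b} :=
    Ideal.mem_span_singleton_self _
  have hw : q (C b * X 0) = q (C a * X 1) := Ideal.Quotient.eq.2 hW
  have key : ∀ j, q (C (![a, b] i)) * q (X j) = q (X i) * q (C (![a, b] j)) := by
    intro j
    rw [← map_mul, ← map_mul]
    fin_cases i <;> fin_cases j <;> simp only [Fin.zero_eta, Fin.mk_one, Matrix.cons_val_zero,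
      Matrix.cons_val_one, Fin.isValue]
    · rw [mul_comm]
    · rw [← hw, mul_comm]
    · rw [hw, mul_comm]
    · rw [mul_comm]
  rw [← Ideal.mem_span_singleton, ← Ideal.Quotient.eq]
  change q _ = q _
  rw [map_mul, map_mul, map_pow, map_pow]
  have e1 : q f = aeval (fun j => q (X j)) f := DFunLike.congr_fun (aeval_unique q) f
  have hq : ∀ r, q (C r) = algebraMap R _ r := q.commutes
  have e2 : q (C (eval ![a, b] f)) = aeval (fun j => q (C (![a, b] j))) f := by
    simp only [hq]
    exact algebraMap_eval _ f
  rw [e1, e2, ← aeval_mul_of_isHomogeneous hf, ← aeval_mul_of_isHomogeneous hf]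
  simp only [key]

theorem exists_eq_linearKernel_mul [IsDomain R] [UniqueFactorizationMonoid R]
    (hrel : IsRelPrime (C a : MvPolynomial (Fin 2) R) (C b)) {m : ℕ}
    {f : MvPolynomial (Fin 2) R} (hf : f.IsHomogeneous (m + 1)) (h0 : eval ![a, b] f = 0) :
    ∃ g : MvPolynomial (Fin 2) R, g.IsHomogeneous m ∧ f = linearKernel a b * g := by
  obtain ⟨g, rfl⟩ : linearKernel a b ∣ f := by
    have h := linearKernel_dvd_pow_mul_sub a b hf
    simp only [h0, map_zero, mul_zero, sub_zero] at h
    exact dvd_of_dvd_mul_of_isRelPrime (hrel.pow (m := m + 1) (n := m + 1)) (h 0) (h 1)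
  -- The quotient is replaced by its component of degree `m`, the only one contributing in degree `m
  -- + 1`.
  refine ⟨homogeneousComponent m g, homogeneousComponent_isHomogeneous m g, ?_⟩
  conv_lhs => rw [← homogeneousComponent_eq_self hf, ← sum_homogeneousComponent g, Finset.mul_sum,
    map_sum]
  have h : ∀ i, homogeneousComponent (m + 1) (linearKernel a b * homogeneousComponent i g)
      = if i = m then linearKernel a b * homogeneousComponent m g else 0 := by
    intro i
    have hi : (linearKernel a b * homogeneousComponent i g).IsHomogeneous (i + 1) := by
      rw [add_comm]
      exact (isHomogeneous_linearKernel a b).mul (homogeneousComponent_isHomogeneous i g)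
    rw [homogeneousComponent_of_mem ((mem_homogeneousSubmodule _ _).2 hi)]
    by_cases hm : i = m
    · subst hm; simp
    · simp [hm, Ne.symm hm]
  simp only [h, Finset.sum_ite_eq', Finset.mem_range]
  split_ifs with hm
  · rfl
  · rw [homogeneousComponent_eq_zero m g (by omega), mul_zero]

theorem map_linearKernel (hD : ∀ f, D f = C a * pderiv 0 f + C b * pderiv 1 f) :
    D (linearKernel a b) = 0 := by
  rw [hD, linearKernel]
  simp [pderiv_X]
  ring

theorem linearKernel_ne_zero [IsDomain R]
    (hrel : IsRelPrime (C a : MvPolynomial (Fin 2) R) (C b)) : linearKernel a b ≠ 0 := by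
  intro h
  have h0 := congrArg (pderiv 0) h
  have h1 := congrArg (pderiv 1) h
  simp [linearKernel, pderiv_X] at h0 h1
  subst h0 h1
  rw [C_0, isRelPrime_zero_left] at hrel
  exact not_isUnit_zero hrel

/-- As long as `k > 0`, `D^[n + k] f = 0` forces `f(a, b) = 0`, so a factor `bX - aY` splits off;
being a nonzero kernel element, it can be cancelled from `h0`. -/
theorem exists_eq_linearKernel_pow_mul [IsDomain R] [UniqueFactorizationMonoid R] [CharZero R]
    (hD : ∀ f, D f = C a * pderiv 0 f + C b * pderiv 1 f)
    (hrel : IsRelPrime (C a : MvPolynomial (Fin 2) R) (C b)) (n k : ℕ)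
    {f : MvPolynomial (Fin 2) R} (hf : f.IsHomogeneous (n + k)) (h0 : D^[n + 1] f = 0) :
    ∃ g : MvPolynomial (Fin 2) R, g.IsHomogeneous n ∧ f = linearKernel a b ^ k * g := by
  induction k generalizing f with
  | zero => exact ⟨f, hf, by simp⟩
  | succ k ih =>
    have h1 : D^[n + k + 1] f = 0 := by
      rw [show n + k + 1 = k + (n + 1) by ring, Function.iterate_add_apply, h0, iterate_zero]
    rw [iterate_eq_factorial_mul_eval hD (n + k + 1) hf, C_eq_zero, mul_eq_zero] at h1
    have h2 := h1.resolve_left (Nat.cast_ne_zero.2 (Nat.factorial_ne_zero _))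
    obtain ⟨g, hg, rfl⟩ := exists_eq_linearKernel_mul hrel hf h2
    rw [iterate_mul D _ (map_linearKernel hD), mul_eq_zero] at h0
    obtain ⟨g', hg', rfl⟩ := ih hg (h0.resolve_left (linearKernel_ne_zero hrel))
    exact ⟨g', hg', by ring⟩

theorem iterate_homogeneousComponent_eq_zero
    (hD : ∀ f, D f = C a * pderiv 0 f + C b * pderiv 1 f) (n : ℕ)
    {f : MvPolynomial (Fin 2) R} (h0 : D^[n] f = 0) (i : ℕ) :
    D^[n] (homogeneousComponent i f) = 0 := by
  have hh := fun j => isHomogeneous_iterate hD n (homogeneousComponent_isHomogeneous j f)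
  have hlt := fun j (hj : j < n) =>
    iterate_eq_zero_of_lt hD hj (homogeneousComponent_isHomogeneous j f)
  -- Degrees below `n` are treated apart: truncated subtraction would send them all to degree 0.
  by_cases hi : i < n
  · exact hlt i hi
  have h : ∀ j, homogeneousComponent (i - n) (D^[n] (homogeneousComponent j f))
      = if j = i then D^[n] (homogeneousComponent i f) else 0 := by
    intro j
    by_cases hj : j < n
    · rw [hlt j hj, map_zero, if_neg (by omega)]
    · rw [homogeneousComponent_of_mem ((mem_homogeneousSubmodule _ _).2 (hh j))]
      by_cases hij : j = i
      · subst hij; simp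
      · rw [if_neg hij, if_neg (by omega)]
  rw [← sum_homogeneousComponent f, iterate_sum] at h0
  have h1 := congrArg (homogeneousComponent (i - n)) h0
  simp only [map_sum, h, map_zero, Finset.sum_ite_eq', Finset.mem_range] at h1
  split_ifs at h1 with hm
  · exact h1
  · rw [homogeneousComponent_eq_zero i f (by omega), iterate_zero]

/-- The `n`-th images of `a ∂/∂X + b ∂/∂Y` lying in its kernel have coefficients in
`(a, b) ^ n` with respect to the powers of the linear form `b X - a Y`. -/
theorem exists_iterate_eq_sum [IsDomain R] [UniqueFactorizationMonoid R] [CharZero R]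
    (hD : ∀ f, D f = C a * pderiv 0 f + C b * pderiv 1 f)
    (hrel : IsRelPrime (C a : MvPolynomial (Fin 2) R) (C b)) (n : ℕ)
    {f : MvPolynomial (Fin 2) R} (h0 : D^[n + 1] f = 0) :
    ∃ (s : Finset ℕ) (r : ℕ → R), (∀ j, r j ∈ Ideal.span {a, b} ^ n) ∧
      D^[n] f = ∑ j ∈ s, C (r j) * linearKernel a b ^ (j - n) := by
  have key : ∀ j, ∃ r ∈ Ideal.span {a, b} ^ n,
      D^[n] (homogeneousComponent j f) = C r * linearKernel a b ^ (j - n) := by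
    intro j
    have hj := homogeneousComponent_isHomogeneous j f
    by_cases hjn : j < n
    · exact ⟨0, zero_mem _, by simp [iterate_eq_zero_of_lt hD hjn hj]⟩
    obtain ⟨k, rfl⟩ := Nat.exists_eq_add_of_le (not_lt.1 hjn)
    obtain ⟨g, hg, hfg⟩ := exists_eq_linearKernel_pow_mul hD hrel n k hj
      (iterate_homogeneousComponent_eq_zero hD _ h0 _)
    have hW : D (linearKernel a b ^ k) = 0 := by
      rw [Derivation.leibniz_pow, map_linearKernel hD, smul_zero, smul_zero]
    refine ⟨n.factorial * eval ![a, b] g, Ideal.mul_mem_left _ _ ?_, ?_⟩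
    · have : ({a, b} : Set R) = Set.range ![a, b] := by
        simp [Matrix.range_cons, Set.pair_comm]
      rw [this, Ideal.mem_span_pow_iff_exists_isHomogeneous]
      exact ⟨g, hg, rfl⟩
    · rw [hfg, iterate_mul D n hW, iterate_eq_factorial_mul_eval hD n hg, mul_comm,
        Nat.add_sub_cancel_left]
  choose r hr hr' using key
  refine ⟨Finset.range (f.totalDegree + 1), r, hr, ?_⟩
  conv_lhs => rw [← sum_homogeneousComponent f, iterate_sum]
  exact Finset.sum_congr rfl fun j _ => hr' j

end

end LND

/-! ### Reduction to the model and computation of the image ideals. -/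

namespace LND

open MvPolynomial

variable {R : Type*} [CommRing R]
  {D : Derivation R (MvPolynomial (Fin 2) R) (MvPolynomial (Fin 2) R)}

theorem derivation_apply_eq (f : MvPolynomial (Fin 2) R) :
    D f = D (X 0) * pderiv 0 f + D (X 1) * pderiv 1 f := by
  have h : D = D (X 0) • pderiv 0 + D (X 1) • pderiv 1 := by
    ext i
    fin_cases i <;> simp [pderiv_X]
  conv_lhs => rw [h]
  simp

/-- Coprimality turns the equation into `f ∣ ∂f/∂Xⱼ`, so that derivative vanishes; then `f * ∂f/∂Xᵢ
= 0` kills the other. -/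
theorem eq_C_of_isRelPrime [IsDomain R] [UniqueFactorizationMonoid R] [CharZero R]
    {f g : MvPolynomial (Fin 2) R} {i j : Fin 2} (hij : ∀ l, l = i ∨ l = j) (hrel : IsRelPrime f g)
    (h : f * pderiv i f + g * pderiv j f = 0) : ∃ r, f = C r := by
  have hj : pderiv j f = 0 := by
    refine pderiv_eq_zero_of_dvd (hrel.dvd_of_dvd_mul_left ⟨-pderiv i f, ?_⟩)
    linear_combination h
  refine exists_eq_C_of_pderiv_eq_zero fun l => ?_
  rcases hij l with rfl | rfl
  · rw [hj, mul_zero, add_zero, mul_eq_zero] at h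
    rcases h with h | h
    · rw [h, map_zero]
    · exact h
  · exact hj

/-- Up to an automorphism, an irreducible nice derivation of `R[X, Y]` is `a ∂/∂X + b ∂/∂Y`
with relatively prime `a` and `b` in `R`. -/
theorem exists_model [IsDomain R] [UniqueFactorizationMonoid R] [CharZero R]
    (hirr : IsIrreducible D) (hnice : IsNice 2 D) :
    ∃ (e : MvPolynomial (Fin 2) R ≃ₐ[R] MvPolynomial (Fin 2) R)
      (D' : Derivation R (MvPolynomial (Fin 2) R) (MvPolynomial (Fin 2) R)) (a b : R),
      (∀ f, e (D' f) = D (e f)) ∧ (∀ f, D' f = C a * pderiv 0 f + C b * pderiv 1 f) ∧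
      IsRelPrime (C a : MvPolynomial (Fin 2) R) (C b) := by
  obtain ⟨x, hx, hDx⟩ := hnice
  let e := AlgEquiv.ofBijective (aeval x) hx
  have he : ∀ i, e (X i) = x i := fun i => aeval_X x i
  let D' := mkDerivation R fun i => e.symm (D (x i))
  have hX : ∀ i, D' (X i) = e.symm (D (x i)) := mkDerivation_X R _
  have hcomm : ∀ f, e (D' f) = D (e f) := by
    intro f
    induction f using MvPolynomial.induction_on with
    | C r =>
      have h1 : D' (C r) = 0 := D'.map_algebraMap r
      have h2 : e (C r) = C r := e.commutes r
      have h3 : D (C r) = 0 := D.map_algebraMap r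
      rw [h1, h2, h3, map_zero]
    | add p q hp hq => simp only [map_add, hp, hq]
    | mul_X p i hp =>
      rw [Derivation.leibniz, map_mul, Derivation.leibniz, hX, he]
      simp only [smul_eq_mul, map_add, map_mul, hp, he, AlgEquiv.apply_symm_apply]
  have hD0 : ∀ i, D' (D' (X i)) = 0 := by
    intro i
    apply e.injective
    rw [hcomm, hcomm, he, hDx, map_zero]
  -- A common divisor of the two values divides the whole image of `D'`, so irreducibility makes it
  -- a unit.
  have hrel : IsRelPrime (D' (X 0)) (D' (X 1)) := by
    intro d h0 h1
    by_contra hd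
    refine hirr ⟨e d, fun hu => hd ?_, fun f => ?_⟩
    · simpa using hu.map e.symm
    · obtain ⟨f, rfl⟩ := e.surjective f
      rw [← hcomm, derivation_apply_eq, Ideal.mem_span_singleton]
      exact map_dvd e (dvd_add (h0.mul_right _) (h1.mul_right _))
  obtain ⟨a, ha⟩ := eq_C_of_isRelPrime (i := 0) (j := 1) (by decide) hrel
    (by rw [← derivation_apply_eq]; exact hD0 0)
  obtain ⟨b, hb⟩ := eq_C_of_isRelPrime (i := 1) (j := 0) (by decide) hrel.symm
    (by rw [add_comm, ← derivation_apply_eq]; exact hD0 1)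
  refine ⟨e, D', a, b, hcomm, fun f => ?_, ha ▸ hb ▸ hrel⟩
  rw [derivation_apply_eq, ha, hb]

section

variable {D' : Derivation R (MvPolynomial (Fin 2) R) (MvPolynomial (Fin 2) R)} {a b : R}
  {e : MvPolynomial (Fin 2) R ≃ₐ[R] MvPolynomial (Fin 2) R}

theorem iterate_comm (he : ∀ f, e (D' f) = D (e f)) (n : ℕ) (f : MvPolynomial (Fin 2) R) :
    D^[n] (e f) = e (D'^[n] f) := by
  induction n with
  | zero => rfl
  | succ n ih => simp only [Function.iterate_succ_apply', ih, he]

/-- The image ideals are extended from the powers of the ideal `(a, b)` of `R`. -/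
theorem imageIdeal_eq_map [IsDomain R] [UniqueFactorizationMonoid R] [CharZero R]
    (hunit : ∀ n : ℕ, IsUnit (n.factorial : R)) (he : ∀ f, e (D' f) = D (e f))
    (hD : ∀ f, D' f = C a * pderiv 0 f + C b * pderiv 1 f)
    (hrel : IsRelPrime (C a : MvPolynomial (Fin 2) R) (C b)) (n : ℕ) :
    imageIdeal D n = (Ideal.span {a, b} ^ n).map (algebraMap R (kernel D)) := by
  apply le_antisymm
  · rintro α ⟨f, hf⟩
    obtain ⟨f, rfl⟩ := e.surjective f
    have hα : D (α : MvPolynomial (Fin 2) R) = 0 := α.2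
    have h0 : D'^[n + 1] f = 0 := by
      apply e.injective
      rw [← iterate_comm he, Function.iterate_succ_apply', hf, hα, map_zero]
    obtain ⟨s, r, hr, hs⟩ := exists_iterate_eq_sum hD hrel n h0
    have hW : D (e (linearKernel a b)) = 0 := by
      rw [← he, map_linearKernel hD, map_zero]
    let w : kernel D := ⟨e (linearKernel a b), hW⟩
    have : α = ∑ j ∈ s, algebraMap R (kernel D) (r j) * w ^ (j - n) := by
      apply Subtype.ext
      rw [← hf, iterate_comm he, hs, map_sum, ← Subalgebra.coe_val, map_sum]
      refine Finset.sum_congr rfl fun j _ => ?_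
      rw [map_mul, map_mul, map_pow, map_pow]
      congr 1
      exact e.commutes (r j)
    rw [this]
    exact Ideal.sum_mem _ fun j _ => Ideal.mul_mem_right _ _ (Ideal.mem_map_of_mem _ (hr j))
  · rw [Ideal.map_le_iff_le_comap, span_pair_pow, Ideal.span_le]
    rintro _ ⟨i, rfl⟩
    -- `u` cancels the `n!` produced by applying the derivation `n` times.
    obtain ⟨u, hu⟩ := (hunit n).exists_right_inv
    have hhom : (C u * (X 0 ^ (i : ℕ) * X 1 ^ (n - i : ℕ)) :
        MvPolynomial (Fin 2) R).IsHomogeneous n := by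
      have := ((isHomogeneous_X_pow (R := R) (0 : Fin 2) (i : ℕ)).mul
        (isHomogeneous_X_pow (1 : Fin 2) (n - i : ℕ))).C_mul u
      rwa [show (i : ℕ) + (n - i) = n by omega] at this
    refine ⟨e (C u * (X 0 ^ (i : ℕ) * X 1 ^ (n - i : ℕ))), ?_⟩
    rw [iterate_comm he, iterate_eq_factorial_mul_eval hD n hhom]
    simp only [map_mul (eval _), eval_C, map_pow (eval _), eval_X, ← mul_assoc, hu, one_mul]
    exact e.commutes _

theorem span_pair_eq_top_of_span_C {R : Type*} [CommRing R] {a b : R}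
    (h : Ideal.span {(C a : MvPolynomial (Fin 2) R), C b} = ⊤) : Ideal.span {a, b} = ⊤ := by
  rw [Ideal.eq_top_iff_one, Ideal.mem_span_pair] at h ⊢
  obtain ⟨u, v, huv⟩ := h
  exact ⟨constantCoeff u, constantCoeff v, by simpa using congrArg constantCoeff huv⟩

theorem isFixedPointFree_iff (he : ∀ f, e (D' f) = D (e f))
    (hD : ∀ f, D' f = C a * pderiv 0 f + C b * pderiv 1 f) :
    IsFixedPointFree D ↔ Ideal.span {a, b} = ⊤ := by
  have hC : ∀ r : R, e (C r) = C r := e.commutes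
  constructor
  · intro h
    apply span_pair_eq_top_of_span_C
    rw [eq_top_iff, ← show Ideal.span (Set.range D) = ⊤ from h, Ideal.span_le]
    rintro _ ⟨f, rfl⟩
    obtain ⟨f, rfl⟩ := e.surjective f
    rw [← he, hD, map_add, map_mul, map_mul, hC, hC]
    exact Ideal.mem_span_pair.2 ⟨e (pderiv 0 f), e (pderiv 1 f), by ring⟩
  · intro h
    have ha : C a ∈ Ideal.span (Set.range D) :=
      Ideal.subset_span ⟨e (X 0), by rw [← he, hD]; simp [pderiv_X, hC]⟩
    have hb : C b ∈ Ideal.span (Set.range D) :=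
      Ideal.subset_span ⟨e (X 1), by rw [← he, hD]; simp [pderiv_X, hC]⟩
    rw [Ideal.eq_top_iff_one, Ideal.mem_span_pair] at h
    obtain ⟨u, v, huv⟩ := h
    rw [IsFixedPointFree, Ideal.eq_top_iff_one, ← C_1, ← huv, C_add, C_mul, C_mul]
    exact add_mem (Ideal.mul_mem_left _ _ ha) (Ideal.mul_mem_left _ _ hb)

end

/-! ### Grade and non-principality of `(a, b)ⁿ A`. -/

section

variable {a b : R}

theorem kernel_span_pair_ne_top (h : Ideal.span {a, b} ≠ ⊤) :
    Ideal.span {algebraMap R (kernel D) a, algebraMap R (kernel D) b} ≠ ⊤ := by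
  intro h'
  apply h
  apply span_pair_eq_top_of_span_C
  have := congrArg (Ideal.map (kernel D).val) h'
  rwa [Ideal.map_top, Ideal.map_span, Set.image_pair] at this

theorem map_pow_le_span_pair {n : ℕ} (hn : 1 ≤ n) :
    (Ideal.span {a, b} ^ n).map (algebraMap R (kernel D)) ≤
      Ideal.span {algebraMap R (kernel D) a, algebraMap R (kernel D) b} := by
  rw [← Set.image_pair, ← Ideal.map_span]
  exact Ideal.map_mono (Ideal.pow_le_self (by omega))

theorem ne_zero_of_span_pair_ne_top
    (hrel : IsRelPrime (C a : MvPolynomial (Fin 2) R) (C b)) (h : Ideal.span {a, b} ≠ ⊤) :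
    a ≠ 0 := by
  rintro rfl
  rw [C_0, isRelPrime_zero_left] at hrel
  have hb : IsUnit b := by simpa using hrel.map (constantCoeff (R := R) (σ := Fin 2))
  exact h (Ideal.eq_top_of_isUnit_mem _ (Ideal.subset_span (by simp)) hb)

theorem grade_map_pow [IsDomain R] [UniqueFactorizationMonoid R]
    (hrel : IsRelPrime (C a : MvPolynomial (Fin 2) R) (C b)) (h : Ideal.span {a, b} ≠ ⊤)
    {n : ℕ} (hn : 1 ≤ n) :
    grade ((Ideal.span {a, b} ^ n).map (algebraMap R (kernel D))) = 2 := by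
  have hle := map_pow_le_span_pair (D := D) (a := a) (b := b) hn
  have hne := kernel_span_pair_ne_top (D := D) h
  refine le_antisymm (grade_le_two hle hne) ?_
  have ha0 : (C a : MvPolynomial (Fin 2) R) ^ n ≠ 0 :=
    pow_ne_zero _ (C_ne_zero.2 (ne_zero_of_span_pair_ne_top hrel h))
  refine two_le_grade (a := algebraMap R (kernel D) a ^ n) (b := algebraMap R (kernel D) b ^ n)
    (fun ht => hne (top_le_iff.1 (ht ▸ hle))) ?_ ?_ ?_ ?_
  · rw [← map_pow]
    exact Ideal.mem_map_of_mem _ (Ideal.pow_mem_pow (Ideal.subset_span (by simp)) _)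
  · rw [← map_pow]
    exact Ideal.mem_map_of_mem _ (Ideal.pow_mem_pow (Ideal.subset_span (by simp)) _)
  · intro t ht
    have h1 : (C a : MvPolynomial (Fin 2) R) ^ n * t = 0 := congrArg Subtype.val ht
    exact Subtype.ext ((mul_eq_zero.1 h1).resolve_left ha0)
  · intro t ht
    obtain ⟨s, hs⟩ := Ideal.mem_span_singleton.1 ht
    have h1 : (C b : MvPolynomial (Fin 2) R) ^ n * t.1 = C a ^ n * s.1 := congrArg Subtype.val hs
    obtain ⟨y, hy⟩ : C a ^ n ∣ (t : MvPolynomial (Fin 2) R) :=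
      (hrel.pow (m := n) (n := n)).dvd_of_dvd_mul_left ⟨s, h1⟩
    -- The division by `aⁿ` took place in `B`; the quotient lies in the kernel because `aⁿ` is a
    -- nonzero constant.
    have hyD : D y = 0 := by
      have ht0 : D (t : MvPolynomial (Fin 2) R) = 0 := t.2
      have han : D (C a ^ n) = 0 := by
        rw [← C_pow]; exact D.map_algebraMap _
      rw [hy, Derivation.leibniz, han, smul_zero, add_zero, smul_eq_mul, mul_eq_zero] at ht0
      exact ht0.resolve_left ha0
    exact Ideal.mem_span_singleton.2 ⟨⟨y, hyD⟩, Subtype.ext hy⟩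

theorem not_isPrincipal_map_pow [IsDomain R] [UniqueFactorizationMonoid R]
    (hrel : IsRelPrime (C a : MvPolynomial (Fin 2) R) (C b)) (h : Ideal.span {a, b} ≠ ⊤)
    {n : ℕ} (hn : 1 ≤ n) :
    ¬ ((Ideal.span {a, b} ^ n).map (algebraMap R (kernel D))).IsPrincipal := by
  rintro ⟨g, hg⟩
  have hdvd : ∀ r ∈ ({a, b} : Set R), (g : MvPolynomial (Fin 2) R) ∣ C r ^ n := by
    intro r hr
    have : algebraMap R (kernel D) (r ^ n) ∈ Ideal.span {g} := by
      rw [← Ideal.submodule_span_eq, ← hg]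
      exact Ideal.mem_map_of_mem _ (Ideal.pow_mem_pow (Ideal.subset_span hr) _)
    have := map_dvd (kernel D).val (Ideal.mem_span_singleton.1 this)
    rw [← C_pow]
    exact this
  have hu : IsUnit (g : MvPolynomial (Fin 2) R) :=
    hrel.pow (m := n) (n := n) (hdvd a (by simp)) (hdvd b (by simp))
  have hmem : g ∈ (Ideal.span {a, b} ^ n).map (algebraMap R (kernel D)) :=
    hg ▸ Ideal.mem_span_singleton_self g
  -- The generator is a unit of `B` lying in `(a, b) B`; taking constant terms then gives `(a, b) =
  -- R`.
  obtain ⟨u, v, huv⟩ := Ideal.mem_span_pair.1 (map_pow_le_span_pair hn hmem)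
  refine h (span_pair_eq_top_of_span_C (Ideal.eq_top_of_isUnit_mem _ ?_ hu))
  exact Ideal.mem_span_pair.2 ⟨u, v, congrArg Subtype.val huv⟩

end

end LND

theorem mainTheorem5 (k R : Type*) [Field k] [CharZero k] [CommRing R] [IsDomain R]
    [UniqueFactorizationMonoid R] [Algebra k R] [Algebra.FiniteType k R]
    (D : Derivation R (MvPolynomial (Fin 2) R) (MvPolynomial (Fin 2) R))
    (hlnd : LND.IsLocallyNilpotent D) (hirr : LND.IsIrreducible D) (hnice : LND.IsNice 2 D) :
    (LND.IsFixedPointFree D → ∀ n : ℕ, 1 ≤ n → LND.imageIdeal D n = ⊤) ∧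
    (¬ LND.IsFixedPointFree D → ∀ n : ℕ, 1 ≤ n →
      (∃ r : Fin (n + 1) → R, LND.imageIdeal D n =
        Ideal.span (Set.range fun i => algebraMap R (LND.kernel D) (r i))) ∧
      LND.grade (LND.imageIdeal D n) = 2 ∧
      ¬ (LND.imageIdeal D n).IsPrincipal) ∧
    ((∀ n : ℕ, 1 ≤ n → (LND.imageIdeal D n).IsPrincipal) ↔ LND.IsFixedPointFree D) := by
  have : CharZero R := charZero_of_injective_algebraMap (algebraMap k R).injective
  have hunit (n : ℕ) : IsUnit (n.factorial : R) := by
    have h : IsUnit (n.factorial : k) := (Nat.cast_ne_zero.2 n.factorial_ne_zero).isUnit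
    simpa using h.map (algebraMap k R)
  obtain ⟨e, D', a, b, he, hD, hrel⟩ := LND.exists_model hirr hnice
  have hI := LND.imageIdeal_eq_map hunit he hD hrel
  have hfpf := LND.isFixedPointFree_iff he hD
  have htop (hF : LND.IsFixedPointFree D) (n : ℕ) : LND.imageIdeal D n = ⊤ := by
    rw [hI, hfpf.1 hF, Ideal.top_pow, Ideal.map_top]
  refine ⟨fun hF n _ => htop hF n, fun hF n hn => ?_, fun hp => ?_, fun hF n _ => ?_⟩
  · have hab := fun h => hF (hfpf.2 h)
    rw [hI]
    refine ⟨⟨fun i => a ^ (i : ℕ) * b ^ (n - i : ℕ), ?_⟩, LND.grade_map_pow hrel hab hn,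
      LND.not_isPrincipal_map_pow hrel hab hn⟩
    rw [LND.span_pair_pow, Ideal.map_span, ← Set.range_comp]
    rfl
  -- Principality of `I₁` alone already forces fixed point freeness.
  · by_contra hF
    refine LND.not_isPrincipal_map_pow (D := D) hrel (fun h => hF (hfpf.2 h)) le_rfl ?_
    rw [← hI]
    exact hp 1 le_rfl
  · rw [htop hF]
    infer_instance
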